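/- **Setting.** Consider a tabular contextual bandit with states $\mathcal S=\{1,\dots,S\}$, actions $\mathcal A=\{1,\dots,A\}$, an initial state distribution $\rho$ on $\mathcal S$ and an unknown reward function $r:\mathcal S\times\mathcal A\to[0,R]$. A policy is a map $\pi:\mathcal S\to\Delta(\mathcal A)$; write $f(s,\pi(s))=\sum_a\pi(a|s)f(s,a)$ and $d^\pi_\rho(s,a)=\rho(s)\pi(a|s)$. A policy $\pi^\star$ is optimal if it maximizes $r(s,\pi(s))$ over policies $\pi$ for all $s$ simultaneously, and $\mathrm{SubOpt}(\pi)=\mathbb E_{s\sim\rho}[r(s,\pi^\star(s))-r(s,\pi(s))]$. The dataset consists of $n\ge1$ i.i.d. samples $(s_i,a_i^0,a_i^1,y_i)$, where $(s_i,a^0_i,a^1_i)\sim d$ for a probability distribution $d$ on $\mathcal S\times\mathcal A\times\mathcal A$ supported on $a^0\ne a^1$, and, given $(s_i,a_i^0,a_i^1)$, the label $y_i\in\{0,1\}$ follows the Bradley–Terry–Luce model $P(y\mid s,a^0,a^1)=\frac{\exp(r(s,a^y))}{\exp(r(s,a^0))+\exp(r(s,a^1))}$. **Pessimistic MLE with radius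 $b'_n$.** Let $\mathcal F=\{v\in\mathbb R^{SA}:\mathbf 1^\top v=0,\ \|v\|_\infty\le R\}$; let $\widetilde r$ be a maximizer over $f\in\mathcal F$ of the BTL log-likelihood $\sum_{i=1}^n\log\frac{\exp(f(s_i,a_i^{y_i}))}{\exp(f(s_i,a_i^0))+\exp(f(s_i,a_i^1))}$; let $\widehat\Sigma=\frac1n\sum_{i=1}^n x_ix_i^\top$ with $x_i=\mathbf 1_{(s_i,a_i^0)}-\mathbf 1_{(s_i,a_i^1)}$; let $\mathcal F_{\mathrm{CR}}(\widetilde r)=\{f\in\mathcal F:\sqrt{(f-\widetilde r)^\top\widehat\Sigma(f-\widetilde r)}\le b'_n\}$. The output $\widehat\pi_{\mathrm{PMLE}}$ is a maximizer over policies $\pi$ of $\min_{\widehat r\in\mathcal F_{\mathrm{CR}}(\widetilde r)}\mathbb E_{s\sim\rho}[\widehat r(s,\pi(s))]$. **Theorem.** There are universal constants $c_b',c_0>0$ such that the following holds for all $S,A,R,r,\rho,d$ as above. Denote $\gamma=\frac1{2+\exp(R\sqrt{SA})+\exp(-R\sqrt{SA})}$. Let $\pi^\star$ be an optimal policy whose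 pairwise concentrability coefficient $$C^\dagger=\sqrt{\sup_{v\in[-1,1]^{SA}:\,\mathbf 1^\top v=0}\frac{\big(\sum_{(s,a)}d^{\pi^\star}_\rho(s,a)v(s,a)\big)^2}{\sum_{(s,a^0,a^1)}d(s,a^0,a^1)\big(v(s,a^0)-v(s,a^1)\big)^2}}$$ (with $0/0=0$ and $x/0=\infty$ for $x>0$) is finite. Let $0<\delta<1$ and $n\ge1$. If one runs pessimistic MLE with $b'_m=c_b'\sqrt{\frac{SA+\log\frac1\delta}{\gamma^2m}}$ (at $m=n$), then with probability at least $1-\delta$ every possible output (for any choice of the maximizers) satisfies $$\mathrm{SubOpt}(\widehat\pi_{\mathrm{PMLE}})\le c_0\,C^\dagger\left(\max\{R,1\}\sqrt{\frac{SA+\log\frac1\delta}{\gamma^2n}}+R\sqrt{\frac{S^2A^2\log\frac n\delta}{n}}\right).$$ For $R\ge1$ the right-hand side is $c_0C^\dagger R\Big(\sqrt{\frac{SA+\log\frac1\delta}{\gamma^2n}}+\sqrt{\frac{S^2A^2\log\frac n\delta}{n}}\Big)$. -/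

import Mathlib

open MeasureTheory Matrix

noncomputable section

namespace PrefBandit

/-- A (possibly randomized) policy: a probability vector over actions at every state. -/
def IsPolicy {S A : ℕ} (π : Fin S → Fin A → ℝ) : Prop :=
  ∀ s, π s ∈ stdSimplex ℝ (Fin A)

/-- Value `E_{a ∼ π(· | s)} [f(s, a)]` of the policy `π` at the state `s` for the reward `f`. -/
def value {S A : ℕ} (f : Fin S × Fin A → ℝ) (π : Fin S → Fin A → ℝ) (s : Fin S) : ℝ :=
  ∑ a, π s a * f (s, a)

/-- `E_{s ∼ ρ} [f(s, π(s))]`. -/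
def avgValue {S A : ℕ} (ρ : Fin S → ℝ) (f : Fin S × Fin A → ℝ) (π : Fin S → Fin A → ℝ) : ℝ :=
  ∑ s, ρ s * value f π s

/-- An optimal policy maximizes the value at all states simultaneously. -/
def IsOptimal {S A : ℕ} (r : Fin S × Fin A → ℝ) (π : Fin S → Fin A → ℝ) : Prop :=
  IsPolicy π ∧ ∀ π', IsPolicy π' → ∀ s, value r π' s ≤ value r π s

/-- Suboptimality of `π`, relative to an optimal policy `πstar`. -/
def subOpt {S A : ℕ} (ρ : Fin S → ℝ) (r : Fin S × Fin A → ℝ)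
    (πstar π : Fin S → Fin A → ℝ) : ℝ :=
  ∑ s, ρ s * (value r πstar s - value r π s)

/-- State-action visitation distribution of `π` started from `ρ`. -/
def visit {S A : ℕ} (ρ : Fin S → ℝ) (π : Fin S → Fin A → ℝ) (x : Fin S × Fin A) : ℝ :=
  ρ x.1 * π x.1 x.2

/-- A preference sample `(s, a⁰, a¹, y)`; `y = true` stands for `y = 1` (`a¹` is preferred). -/
abbrev Sample (S A : ℕ) : Type := Fin S × Fin A × Fin A × Bool

/-- Bradley-Terry-Luce probability of the response `y` in the comparison of `(s, a0)` and
`(s, a1)` under the reward `f`. -/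
def btl {S A : ℕ} (f : Fin S × Fin A → ℝ) (s : Fin S) (a0 a1 : Fin A) (y : Bool) : ℝ :=
  Real.exp (f (s, if y then a1 else a0)) / (Real.exp (f (s, a0)) + Real.exp (f (s, a1)))

/-- Law of one preference sample: `(s, a⁰, a¹) ∼ d`, then `y` from the BTL model with reward
`r`. -/
def sampleLaw {S A : ℕ} (d : Fin S × Fin A × Fin A → ℝ) (r : Fin S × Fin A → ℝ) :
    Measure (Sample S A) :=
  ∑ s, ∑ a0, ∑ a1, ∑ y,
    ENNReal.ofReal (d (s, a0, a1) * btl r s a0 a1 y) • Measure.dirac (s, a0, a1, y)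

/-- Law of a dataset of `n` i.i.d. preference samples. -/
def dataLaw {S A : ℕ} (n : ℕ) (d : Fin S × Fin A × Fin A → ℝ) (r : Fin S × Fin A → ℝ) :
    Measure (Fin n → Sample S A) :=
  Measure.pi fun _ => sampleLaw d r

/-- The reward class `{v ∈ ℝ^{SA} : 1ᵀ v = 0, ‖v‖_∞ ≤ R}`. -/
def rewardClass (S A : ℕ) (R : ℝ) : Set (Fin S × Fin A → ℝ) :=
  {v | ∑ x, v x = 0 ∧ ∀ x, |v x| ≤ R}

/-- Log-likelihood of the reward `f` on the dataset `D`. -/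
def logLik {S A n : ℕ} (D : Fin n → Sample S A) (f : Fin S × Fin A → ℝ) : ℝ :=
  ∑ i, Real.log (btl f (D i).1 (D i).2.1 (D i).2.2.1 (D i).2.2.2)

/-- `rt` is a maximum likelihood estimate over the reward class. -/
def IsMLE {S A n : ℕ} (R : ℝ) (D : Fin n → Sample S A) (rt : Fin S × Fin A → ℝ) : Prop :=
  rt ∈ rewardClass S A R ∧ ∀ f ∈ rewardClass S A R, logLik D f ≤ logLik D rt

/-- The vector `1_{(s, a⁰)} - 1_{(s, a¹)}` of a sample. -/
def diffVec {S A : ℕ} (z : Sample S A) : Fin S × Fin A → ℝ :=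
  Pi.single (z.1, z.2.1) 1 - Pi.single (z.1, z.2.2.1) 1

/-- Empirical covariance matrix. -/
def empCov {S A n : ℕ} (D : Fin n → Sample S A) :
    Matrix (Fin S × Fin A) (Fin S × Fin A) ℝ :=
  (1 / (n : ℝ)) • ∑ i, vecMulVec (diffVec (D i)) (diffVec (D i))

/-- Pessimistic reward set of radius `b` around `rt`. -/
def confSet {S A n : ℕ} (R b : ℝ) (D : Fin n → Sample S A) (rt : Fin S × Fin A → ℝ) :
    Set (Fin S × Fin A → ℝ) :=
  {f | f ∈ rewardClass S A R ∧ Real.sqrt ((f - rt) ⬝ᵥ (empCov D *ᵥ (f - rt))) ≤ b}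

/-- `min_{f ∈ confSet} E_{s ∼ ρ} [f(s, π(s))]`. -/
def pessValue {S A n : ℕ} (ρ : Fin S → ℝ) (R b : ℝ) (D : Fin n → Sample S A)
    (rt : Fin S × Fin A → ℝ) (π : Fin S → Fin A → ℝ) : ℝ :=
  sInf ((fun f => avgValue ρ f π) '' confSet R b D rt)

/-- `π` is a possible output of pessimistic MLE with confidence radius `b` on the dataset `D`
(for some choice of the maximizers in the two optimization steps). -/
def IsPMLEOutput {S A n : ℕ} (ρ : Fin S → ℝ) (R b : ℝ) (D : Fin n → Sample S A)
    (π : Fin S → Fin A → ℝ) : Prop :=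
  ∃ rt, IsMLE R D rt ∧ IsPolicy π ∧
    ∀ π', IsPolicy π' → pessValue ρ R b D rt π' ≤ pessValue ρ R b D rt π

/-- Pairwise concentrability coefficient, with values in `[0, ∞]`. A ratio `x / 0` is `∞` for
`x > 0`, and `0 / 0` is `0` (it does not contribute to the supremum). -/
def Cdagger {S A : ℕ} (ρ : Fin S → ℝ) (d : Fin S × Fin A × Fin A → ℝ)
    (πstar : Fin S → Fin A → ℝ) : ENNReal :=
  (⨆ v ∈ {v : Fin S × Fin A → ℝ | (∀ x, v x ∈ Set.Icc (-1 : ℝ) 1) ∧ ∑ x, v x = 0},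
    ENNReal.ofReal ((∑ x, visit ρ πstar x * v x) ^ 2) /
      ENNReal.ofReal (∑ s, ∑ a0, ∑ a1, d (s, a0, a1) * (v (s, a0) - v (s, a1)) ^ 2))
    ^ (1 / 2 : ℝ)

/-- `γ = 1 / (2 + exp(R √(SA)) + exp(-R √(SA)))`. -/
def gam (S A : ℕ) (R : ℝ) : ℝ :=
  1 / (2 + Real.exp (R * Real.sqrt ((S : ℝ) * A)) + Real.exp (-(R * Real.sqrt ((S : ℝ) * A))))

/-- `√((SA + log(1/δ)) / (γ² m))`. -/
def mleRate (S A : ℕ) (R δ : ℝ) (m : ℕ) : ℝ :=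
  Real.sqrt (((S : ℝ) * A + Real.log (1 / δ)) / (gam S A R ^ 2 * m))

/-- `√(S² A² log(m/δ) / m)`. -/
def covRate (S A : ℕ) (δ : ℝ) (m : ℕ) : ℝ :=
  Real.sqrt ((S : ℝ) ^ 2 * (A : ℝ) ^ 2 * Real.log (m / δ) / m)

end PrefBandit

end

noncomputable section

namespace PrefBandit

variable {S A : ℕ}

/-! ### Scalar inequalities for the logistic model -/

/-! Two concentration events, each failing with probability at most `δ / 2`, reduce the theorem to a
deterministic argument.

Score event (`dataLaw_score_le`): given the comparisons, the label noise is a sub-Gaussian vector,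
and its projection onto the space of reward-gap vectors, of dimension at most `S * A`, has norm at
most `K = 8 √(SA + log (1/δ))`. Rewards matter only up to an additive constant, so the mean-zero
shift `centered r` competes in the likelihood. The log-partition function is strongly convex on the
relevant range (`bregman_lower`), so `mle_error_le` bounds the empirical distance from the MLE to
`centered r`. Hence the true reward lies in the confidence set.

Count event (`dataLaw_count_le`): each comparison occurs about at least half as often as expected,
so the population form `popVar` is dominated by the empirical one plus a term of order `log (n/δ) /
n` (`popVar_le_of_count`).

Pessimism (`subOpt_le_of_mem_confSet`) bounds the suboptimality by the difference of the values of
`πstar` under `centered r` and under an element `f` of the confidence set. Concentrability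
(`abs_sum_visit_le`) converts this difference into `Cdagger` times the square root of `popVar d
(centered r - f)`. -/

theorem sq_div_le_sub_one_add_exp_neg {u : ℝ} (hu : 0 ≤ u) :
    u ^ 2 / (2 + u) ≤ u - 1 + Real.exp (-u) := by
  have key : 0 ≤ (2 + u) * Real.exp (-u) + u - 2 := by
    have hmono : MonotoneOn (fun x : ℝ => (2 + x) * Real.exp (-x) + x - 2) (Set.Ici 0) := by
      apply monotoneOn_of_deriv_nonneg (convex_Ici 0)
      · fun_prop
      · fun_prop
      · intro x _
        have hd : HasDerivAt (fun x : ℝ => (2 + x) * Real.exp (-x) + x - 2)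
            (1 * Real.exp (-x) + (2 + x) * (Real.exp (-x) * (-1)) + 1) x :=
          (((((hasDerivAt_id x).const_add 2).mul ((hasDerivAt_neg x).exp)).add
            (hasDerivAt_id x)).sub_const 2)
        rw [hd.deriv]
        have h1 : Real.exp (-x) * Real.exp x = 1 := by rw [← Real.exp_add]; simp
        nlinarith [Real.add_one_le_exp x, Real.exp_pos (-x)]
    have := hmono (Set.self_mem_Ici) hu hu
    simpa using this
  rw [div_le_iff₀ (by linarith)]
  nlinarith

/-- Both sides vanish at `0`. Their derivatives are `pq (exp x - 1)` divided by `exp x` on the left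
and by `q + p exp x` on the right, and `q + p exp x ≤ exp x` for `x ≥ 0`. -/
theorem log_mgf_lower_of_nonneg {p q u : ℝ} (hp : 0 < p) (hq : 0 < q) (hpq : p + q = 1)
    (hu : 0 ≤ u) :
    p * q * (u - 1 + Real.exp (-u)) ≤ Real.log (q + p * Real.exp u) - p * u := by
  have hpos : ∀ x : ℝ, 0 < q + p * Real.exp x := fun x => by positivity
  have hd : ∀ x : ℝ, HasDerivAt
      (fun x : ℝ => Real.log (q + p * Real.exp x) - p * x - p * q * (x - 1 + Real.exp (-x)))
      (p * Real.exp x / (q + p * Real.exp x) - p * 1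
        - p * q * (1 + Real.exp (-x) * (-1))) x := fun x =>
    (((((Real.hasDerivAt_exp x).const_mul p).const_add q).log (hpos x).ne').sub
      ((hasDerivAt_id x).const_mul p)).sub
      ((((hasDerivAt_id x).sub_const 1).add ((hasDerivAt_neg x).exp)).const_mul (p * q))
  have hmono : MonotoneOn
      (fun x : ℝ => Real.log (q + p * Real.exp x) - p * x - p * q * (x - 1 + Real.exp (-x)))
      (Set.Ici 0) := by
    apply monotoneOn_of_deriv_nonneg (convex_Ici 0)
    · exact fun x _ => (hd x).continuousAt.continuousWithinAt
    · exact fun x _ => (hd x).differentiableAt.differentiableWithinAt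
    · intro x hx
      rw [interior_Ici] at hx
      have hx0 : (0 : ℝ) < x := hx
      rw [(hd x).deriv]
      have he : 1 ≤ Real.exp x := Real.one_le_exp hx0.le
      have hq' : q = 1 - p := by linarith
      have h1 : p * Real.exp x / (q + p * Real.exp x) - p * 1
          = p * q * ((Real.exp x - 1) / (q + p * Real.exp x)) := by
        rw [mul_div_assoc', eq_div_iff (hpos x).ne', sub_mul, div_mul_cancel₀ _ (hpos x).ne']
        subst hq'; ring
      have h2 : 1 + Real.exp (-x) * (-1) = (Real.exp x - 1) / Real.exp x := by
        rw [Real.exp_neg]; field_simp; ring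
      rw [h1, h2, ← mul_sub]
      apply mul_nonneg (by positivity)
      rw [sub_nonneg]
      apply div_le_div_of_nonneg_left (by linarith) (hpos x)
      nlinarith
  have := hmono (Set.self_mem_Ici) hu hu
  simp only [Real.exp_zero, neg_zero, mul_one, mul_zero, add_comm q p, hpq, Real.log_one] at this
  linarith

theorem log_mgf_lower {p q : ℝ} (u : ℝ) (hp : 0 < p) (hq : 0 < q) (hpq : p + q = 1) :
    p * q * (u ^ 2 / (2 + |u|)) ≤ Real.log (q + p * Real.exp u) - p * u := by
  rcases le_total 0 u with hu | hu
  · rw [abs_of_nonneg hu]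
    exact (mul_le_mul_of_nonneg_left (sq_div_le_sub_one_add_exp_neg hu) (by positivity)).trans
      (log_mgf_lower_of_nonneg hp hq hpq hu)
  · have hu' : 0 ≤ -u := by linarith
    rw [abs_of_nonpos hu]
    have h := (mul_le_mul_of_nonneg_left (sq_div_le_sub_one_add_exp_neg hu')
      (mul_pos hq hp).le).trans
      (log_mgf_lower_of_nonneg hq hp (by linarith) hu')
    -- For negative `u`, factoring out `exp u` exchanges the roles of `p` and `q`.
    have h3 : q + p * Real.exp u = Real.exp u * (p + q * Real.exp (-u)) := by
      rw [Real.exp_neg]; field_simp; ring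
    rw [h3, Real.log_mul (Real.exp_pos u).ne' (by positivity), Real.log_exp]
    rw [neg_sq] at h
    have : p = 1 - q := by linarith
    subst this
    linarith

/-- The probability that `true` is preferred when the reward gap is `a`. -/
def logistic (a : ℝ) : ℝ := Real.exp a / (1 + Real.exp a)

theorem logistic_pos (a : ℝ) : 0 < logistic a := by unfold logistic; positivity

theorem one_sub_logistic (a : ℝ) : 1 - logistic a = 1 / (1 + Real.exp a) := by
  unfold logistic; field_simp; ring

theorem logistic_lt_one (a : ℝ) : logistic a < 1 := by
  have : 0 < 1 - logistic a := by rw [one_sub_logistic]; positivity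
  linarith

/-- The Bregman divergence of the log-partition function `a ↦ log (1 + exp a)` is quadratic. -/
theorem bregman_lower {R a b : ℝ} (ha : |a| ≤ R) (hb : |b - a| ≤ 3 * R) :
    Real.exp (-(7 / 5 * R)) / 32 * (b - a) ^ 2 ≤
      Real.log (1 + Real.exp b) - Real.log (1 + Real.exp a) - logistic a * (b - a) := by
  have hR : 0 ≤ R := (abs_nonneg a).trans ha
  have h := log_mgf_lower (b - a) (logistic_pos a) (sub_pos.2 (logistic_lt_one a)) (by ring)
  have hlog : Real.log (1 - logistic a + logistic a * Real.exp (b - a))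
      = Real.log (1 + Real.exp b) - Real.log (1 + Real.exp a) := by
    rw [← Real.log_div (by positivity) (by positivity), one_sub_logistic, logistic, Real.exp_sub]
    congr 1
    field_simp
  rw [hlog] at h
  refine le_trans ?_ h
  have hpq : Real.exp (-R) / 4 ≤ logistic a * (1 - logistic a) := by
    rw [one_sub_logistic, logistic, Real.exp_neg]
    have h1 := Real.exp_le_exp.2 (abs_le.1 ha).2
    have h2 := Real.exp_le_exp.2 (neg_le.1 (abs_le.1 ha).1)
    have h3 : Real.exp a * Real.exp (-a) = 1 := by rw [← Real.exp_add]; simp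
    have h4 : 1 ≤ Real.exp R := Real.one_le_exp hR
    have h5 := Real.exp_pos a
    rw [div_mul_div_comm, inv_eq_one_div, div_div, div_le_div_iff₀ (by positivity) (by positivity)]
    nlinarith
  have hfrac : (b - a) ^ 2 / (2 + 3 * R) ≤ (b - a) ^ 2 / (2 + |b - a|) := by
    apply div_le_div_of_nonneg_left (sq_nonneg _) (by positivity) (by linarith)
  refine le_trans ?_ (mul_le_mul hpq hfrac (by positivity)
    (by nlinarith [logistic_pos a, logistic_lt_one a]))
  have he : Real.exp (-R) = Real.exp (-(7 / 5 * R)) * Real.exp (2 / 5 * R) := by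
    rw [← Real.exp_add]; ring_nf
  -- The factor `1 / (2 + 3R)` is absorbed by weakening the exponent from `R` to `7/5 R`. This stays
  -- affordable because `7/5 ≤ √2 ≤ √(SA)`, as used in `gam_le_exp`.
  have hg := Real.add_one_le_exp (2 / 5 * R)
  have : Real.exp (-(7 / 5 * R)) / 32 ≤ Real.exp (-R) / 4 / (2 + 3 * R) := by
    rw [le_div_iff₀ (by positivity), he]
    nlinarith [Real.exp_pos (-(7 / 5 * R))]
  calc _ ≤ Real.exp (-R) / 4 / (2 + 3 * R) * (b - a) ^ 2 :=
        mul_le_mul_of_nonneg_right this (sq_nonneg _)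
    _ = _ := by ring

/-- A centred Bernoulli variable is sub-Gaussian. -/
theorem bernoulli_mgf_le {p : ℝ} (hp0 : 0 ≤ p) (hp1 : p ≤ 1) (l : ℝ) :
    p * Real.exp (l * (1 - p)) + (1 - p) * Real.exp (l * (0 - p)) ≤ Real.exp (l ^ 2 / 2) := by
  -- Symmetrization: `N` is the moment generating function at `-l`, at least `1` since the variable
  -- is centred, and `M * N` is that of the difference of two independent copies.
  set M := p * Real.exp (l * (1 - p)) + (1 - p) * Real.exp (l * (0 - p)) with hM
  set N := p * Real.exp (-(l * (1 - p))) + (1 - p) * Real.exp (-(l * (0 - p))) with hN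
  have hN1 : 1 ≤ N := by
    have h1 := Real.add_one_le_exp (-(l * (1 - p)))
    have h2 := Real.add_one_le_exp (-(l * (0 - p)))
    nlinarith
  have hM0 : 0 ≤ M := by
    have : 0 ≤ 1 - p := by linarith
    positivity
  have hMN : M * N = 1 + 2 * (p * (1 - p)) * (Real.cosh l - 1) := by
    have e1 : Real.exp (l * (1 - p)) * Real.exp (-(l * (1 - p))) = 1 := by
      rw [← Real.exp_add]; simp
    have e2 : Real.exp (l * (0 - p)) * Real.exp (-(l * (0 - p))) = 1 := by
      rw [← Real.exp_add]; simp
    have e3 : Real.exp (l * (1 - p)) * Real.exp (-(l * (0 - p))) = Real.exp l := by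
      rw [← Real.exp_add]; ring_nf
    have e4 : Real.exp (l * (0 - p)) * Real.exp (-(l * (1 - p))) = Real.exp (-l) := by
      rw [← Real.exp_add]; ring_nf
    rw [Real.cosh_eq, hM, hN]
    linear_combination p ^ 2 * e1 + (1 - p) ^ 2 * e2 + p * (1 - p) * e3 + p * (1 - p) * e4
  have hc := Real.one_le_cosh l
  calc M ≤ M * N := by nlinarith
    _ ≤ Real.cosh l := by rw [hMN]; nlinarith [sq_nonneg (p - 1 / 2)]
    _ ≤ _ := Real.cosh_le_exp_half_sq l

/-! ### A finite net in a finite-dimensional subspace -/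

/-- A 1-separated subset of the ball of radius 2 with the most elements is automatically a 1-net;
the volume bound `5 ^ dim` ensures that a maximum exists. -/
theorem exists_separated_net (E : Type*) [NormedAddCommGroup E] [NormedSpace ℝ E]
    [FiniteDimensional ℝ E] :
    ∃ T : Finset E, T.card ≤ 5 ^ Module.finrank ℝ E ∧ (∀ t ∈ T, ‖t‖ ≤ 2) ∧
      ∀ v : E, ‖v‖ ≤ 2 → ∃ t ∈ T, ‖v - t‖ ≤ 1 := by
  classical
  let P : Finset E → Prop := fun T =>
    (∀ c ∈ T, ‖c‖ ≤ 2) ∧ ∀ c ∈ T, ∀ d ∈ T, c ≠ d → 1 ≤ ‖c - d‖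
  have hcard : ∀ T, P T → T.card ≤ 5 ^ Module.finrank ℝ E := fun T hT =>
    Besicovitch.card_le_of_separated T hT.1 hT.2
  let Q : ℕ → Prop := fun k => ∃ T, P T ∧ T.card = k
  have hQ : Q (Nat.findGreatest Q (5 ^ Module.finrank ℝ E)) :=
    Nat.findGreatest_spec (P := Q) (Nat.zero_le _) ⟨∅, ⟨by simp, by simp⟩, rfl⟩
  obtain ⟨T, hT, hTc⟩ := hQ
  refine ⟨T, hcard T hT, hT.1, fun v hv => ?_⟩
  by_contra! hcon
  have hvT : v ∉ T := fun h => by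
    have := hcon v h
    rw [sub_self, norm_zero] at this
    linarith
  have hP : P (insert v T) := by
    refine ⟨fun c hc => ?_, fun c hc d hd hcd => ?_⟩
    · rcases Finset.mem_insert.1 hc with rfl | hc
      · exact hv
      · exact hT.1 c hc
    · rcases Finset.mem_insert.1 hc with hcv | hc' <;>
        rcases Finset.mem_insert.1 hd with hdv | hd'
      · exact absurd (hcv.trans hdv.symm) hcd
      · rw [hcv]; exact (hcon d hd').le
      · rw [hdv, norm_sub_rev]; exact (hcon c hc').le
      · exact hT.2 c hc' d hd' hcd
  have := Nat.le_findGreatest (P := Q) (hcard _ hP) ⟨_, hP, rfl⟩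
  rw [Finset.card_insert_of_notMem hvT, hTc] at this
  omega

/-- The norm of the projection of a vector onto a subspace is controlled on a finite net. -/
theorem exists_net_inner_le {E : Type*} [NormedAddCommGroup E] [InnerProductSpace ℝ E]
    [FiniteDimensional ℝ E] (W : Submodule ℝ E) :
    ∃ T : Finset E, T.card ≤ 5 ^ Module.finrank ℝ W ∧ (∀ t ∈ T, ‖t‖ ≤ 2) ∧
      ∀ (e : E) (K : ℝ), (∀ t ∈ T, inner ℝ e t ≤ K) → ∀ w ∈ W, inner ℝ e w ≤ K * ‖w‖ := by
  classical
  obtain ⟨T, hc, hb, hn⟩ := exists_separated_net W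
  refine ⟨T.image (fun t : W => (t : E)), Finset.card_image_le.trans hc, ?_, ?_⟩
  · simp only [Finset.mem_image]
    rintro _ ⟨t, ht, rfl⟩
    exact hb t ht
  intro e K hK w hw
  set g : W := W.orthogonalProjectionOnto e with hg
  have hinner : ∀ t : W, inner ℝ e (t : E) = inner ℝ g t := fun t => by
    rw [hg, Submodule.inner_orthogonalProjectionOnto_eq_of_mem_right]
  have hgK : ‖g‖ ≤ K := by
    rcases eq_or_ne g 0 with h0 | h0
    -- When the projection vanishes, any net point yields `0 ≤ K`.
    · obtain ⟨t, ht, -⟩ := hn 0 (by simp)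
      have h1 := hK t (Finset.mem_image_of_mem _ ht)
      rw [hinner, h0, inner_zero_left] at h1
      rw [h0, norm_zero]; exact h1
    · have hg0 : 0 < ‖g‖ := norm_pos_iff.2 h0
      -- A net point `t` within distance 1 of the vector of length 2 along `g` has inner product
      -- with `g` at least `2‖g‖ - ‖g‖ = ‖g‖`.
      obtain ⟨t, ht, htn⟩ := hn ((2 / ‖g‖) • g) (by
        rw [norm_smul, Real.norm_of_nonneg (by positivity), div_mul_cancel₀ _ hg0.ne'])
      have h1 := hK t (Finset.mem_image_of_mem _ ht)
      rw [hinner] at h1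
      have h2 := real_inner_le_norm g ((2 / ‖g‖) • g - t)
      rw [inner_sub_right, real_inner_smul_right, real_inner_self_eq_norm_sq] at h2
      have h3 : 2 / ‖g‖ * ‖g‖ ^ 2 = 2 * ‖g‖ := by field_simp
      rw [h3] at h2
      nlinarith
  calc inner ℝ e w = inner ℝ g (⟨w, hw⟩ : W) := hinner ⟨w, hw⟩
    _ ≤ ‖g‖ * ‖(⟨w, hw⟩ : W)‖ := real_inner_le_norm _ _
    _ ≤ K * ‖w‖ := mul_le_mul_of_nonneg_right hgK (norm_nonneg _)

/-! ### The law of the dataset as a finite weighted sum -/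

/-- Reward gap between the second and the first action of a comparison. -/
def gap (f : Fin S × Fin A → ℝ) (c : Fin S × Fin A × Fin A) : ℝ :=
  f (c.1, c.2.2) - f (c.1, c.2.1)

/-- Numerical value of a label. -/
def label (y : Bool) : ℝ := if y then 1 else 0

/-- The comparison shown in a sample. -/
def query (z : Sample S A) : Fin S × Fin A × Fin A := (z.1, z.2.1, z.2.2.1)

theorem btl_true (f : Fin S × Fin A → ℝ) (s : Fin S) (a0 a1 : Fin A) :
    btl f s a0 a1 true = logistic (gap f (s, a0, a1)) := by
  simp only [btl, logistic, gap, if_true, Real.exp_sub]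
  field_simp

theorem btl_false (f : Fin S × Fin A → ℝ) (s : Fin S) (a0 a1 : Fin A) :
    btl f s a0 a1 false = 1 - logistic (gap f (s, a0, a1)) := by
  rw [one_sub_logistic]
  simp only [btl, gap, Real.exp_sub, Bool.false_eq_true, if_false]
  field_simp

theorem btl_pos (f : Fin S × Fin A → ℝ) (s : Fin S) (a0 a1 : Fin A) (y : Bool) :
    0 < btl f s a0 a1 y := by
  unfold btl; positivity

theorem sum_btl (f : Fin S × Fin A → ℝ) (s : Fin S) (a0 a1 : Fin A) :
    ∑ y, btl f s a0 a1 y = 1 := by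
  rw [Fintype.sum_bool, btl_true, btl_false]; ring

theorem sum_sample {M : Type*} [AddCommMonoid M] (g : Sample S A → M) :
    ∑ z, g z = ∑ c : Fin S × Fin A × Fin A, ∑ y, g (c.1, c.2.1, c.2.2, y) := by
  simp only [Fintype.sum_prod_type]

/-- Probability of a sample. -/
def weight (d : Fin S × Fin A × Fin A → ℝ) (r : Fin S × Fin A → ℝ) (z : Sample S A) : ℝ :=
  d (query z) * btl r z.1 z.2.1 z.2.2.1 z.2.2.2

section Law

variable {d : Fin S × Fin A × Fin A → ℝ} {r : Fin S × Fin A → ℝ}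

theorem weight_nonneg (hd : d ∈ stdSimplex ℝ (Fin S × Fin A × Fin A)) (z : Sample S A) :
    0 ≤ weight d r z :=
  mul_nonneg (hd.1 _) (btl_pos _ _ _ _ _).le

theorem sum_weight_mul (g : Fin S × Fin A × Fin A → ℝ) :
    ∑ z, weight d r z * g (query z) = ∑ c, d c * g c := by
  rw [sum_sample]
  refine Finset.sum_congr rfl fun c _ => ?_
  simp only [weight, query]
  rw [← Finset.sum_mul, ← Finset.mul_sum, sum_btl, mul_one]

theorem sampleLaw_eq : sampleLaw d r
    = ∑ z, ENNReal.ofReal (weight d r z) • Measure.dirac z := by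
  simp only [sampleLaw, weight, query, Fintype.sum_prod_type]

theorem sampleLaw_singleton (z : Sample S A) :
    sampleLaw d r {z} = ENNReal.ofReal (weight d r z) := by
  classical
  rw [sampleLaw_eq, Measure.finsetSum_apply, Finset.sum_eq_single z]
  · simp
  · intro b _ hb
    simp [hb]
  · simp

theorem isProbabilityMeasure_sampleLaw (hd : d ∈ stdSimplex ℝ (Fin S × Fin A × Fin A)) :
    IsProbabilityMeasure (sampleLaw d r) := by
  constructor
  rw [sampleLaw_eq, Measure.finsetSum_apply]
  simp only [Measure.smul_apply, measure_univ, smul_eq_mul, mul_one]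
  rw [← ENNReal.ofReal_sum_of_nonneg fun z _ => weight_nonneg hd z]
  have := sum_weight_mul (d := d) (r := r) fun _ => 1
  simp only [mul_one] at this
  rw [this, hd.2, ENNReal.ofReal_one]

theorem dataLaw_singleton {n : ℕ} (hd : d ∈ stdSimplex ℝ (Fin S × Fin A × Fin A))
    (D : Fin n → Sample S A) :
    dataLaw n d r {D} = ENNReal.ofReal (∏ i, weight d r (D i)) := by
  have := isProbabilityMeasure_sampleLaw (r := r) hd
  rw [dataLaw, Measure.pi_singleton, ENNReal.ofReal_prod_of_nonneg fun i _ => weight_nonneg hd _]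
  simp only [sampleLaw_singleton]

/-- Markov's inequality for the law of the dataset. -/
theorem dataLaw_le_of_one_le {n : ℕ} (hd : d ∈ stdSimplex ℝ (Fin S × Fin A × Fin A))
    (B : Set (Fin n → Sample S A)) (F : (Fin n → Sample S A) → ℝ) (hF : ∀ D, 0 ≤ F D)
    (hB : ∀ D ∈ B, 1 ≤ F D) {ε : ℝ} (hε : ∑ D, (∏ i, weight d r (D i)) * F D ≤ ε) :
    dataLaw n d r B ≤ ENNReal.ofReal ε := by
  classical
  have hw : ∀ D : Fin n → Sample S A, 0 ≤ ∏ i, weight d r (D i) :=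
    fun D => Finset.prod_nonneg fun i _ => weight_nonneg hd _
  have h1 : dataLaw n d r B ≤ ∑ D ∈ B.toFinset, dataLaw n d r {D} := by
    calc dataLaw n d r B = dataLaw n d r (⋃ D ∈ B.toFinset, {D}) := by
          congr 1; ext; simp
      _ ≤ _ := measure_biUnion_finset_le _ _
  refine h1.trans ?_
  simp only [dataLaw_singleton hd]
  rw [← ENNReal.ofReal_sum_of_nonneg fun D _ => hw D]
  apply ENNReal.ofReal_le_ofReal
  refine le_trans ?_ hε
  calc ∑ D ∈ B.toFinset, ∏ i, weight d r (D i)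
      ≤ ∑ D ∈ B.toFinset, (∏ i, weight d r (D i)) * F D :=
        Finset.sum_le_sum fun D hD => le_mul_of_one_le_right (hw D) (hB D (by simpa using hD))
    _ ≤ _ := Finset.sum_le_sum_of_subset_of_nonneg (Finset.subset_univ _)
        fun D _ _ => mul_nonneg (hw D) (hF D)

/-- The comparisons and the labels of a dataset. -/
def dataEquiv (S A n : ℕ) :
    (Fin n → Fin S × Fin A × Fin A) × (Fin n → Bool) ≃ (Fin n → Sample S A) where
  toFun p i := ((p.1 i).1, (p.1 i).2.1, (p.1 i).2.2, p.2 i)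
  invFun D := (fun i => query (D i), fun i => (D i).2.2.2)
  left_inv _ := rfl
  right_inv _ := rfl

/-- Conditioning on the comparisons: the inner sum is the conditional expectation over independent
labels, which lets the net in `dataLaw_score_le` depend on the comparisons. -/
theorem sum_data {n : ℕ} (G : (Fin n → Sample S A) → ℝ) :
    ∑ D, (∏ i, weight d r (D i)) * G D
      = ∑ X : Fin n → Fin S × Fin A × Fin A, (∏ i, d (X i)) *
          ∑ Y : Fin n → Bool, (∏ i, btl r (X i).1 (X i).2.1 (X i).2.2 (Y i)) *
            G (dataEquiv S A n (X, Y)) := by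
  rw [← (dataEquiv S A n).sum_comp, Fintype.sum_prod_type]
  refine Finset.sum_congr rfl fun X _ => ?_
  rw [Finset.mul_sum]
  refine Finset.sum_congr rfl fun Y _ => ?_
  rw [← mul_assoc, ← Finset.prod_mul_distrib]
  rfl

theorem sum_prod_eq_one {n : ℕ} (hd : d ∈ stdSimplex ℝ (Fin S × Fin A × Fin A)) :
    ∑ X : Fin n → Fin S × Fin A × Fin A, ∏ i, d (X i) = 1 := by
  rw [← Fintype.piFinset_univ, ← Finset.prod_univ_sum (fun _ => Finset.univ) (fun _ c => d c)]
  simp [hd.2]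

end Law

/-! ### Concentration of the comparison frequencies -/

/-- Number of times the comparison `c` occurs in the dataset. -/
def count {n : ℕ} (D : Fin n → Sample S A) (c : Fin S × Fin A × Fin A) : ℝ :=
  ∑ i, if query (D i) = c then 1 else 0

theorem exp_neg_one_le_half : Real.exp (-1) ≤ 1 / 2 := by
  have := Real.add_one_le_exp (1 : ℝ)
  rw [Real.exp_neg, inv_eq_one_div, div_le_div_iff₀ (Real.exp_pos _) (by norm_num)]
  linarith

/-- One-sample Chernoff factor for the lower tail. The expectation is `exp (d c / 2) * (1 - (1 -
e⁻¹) d c)`, and `1 - e⁻¹ ≥ 1/2`. -/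
theorem sum_weight_exp_le_one {d : Fin S × Fin A × Fin A → ℝ} {r : Fin S × Fin A → ℝ}
    (hd : d ∈ stdSimplex ℝ (Fin S × Fin A × Fin A)) (c : Fin S × Fin A × Fin A) :
    ∑ z, weight d r z * Real.exp (d c / 2 - if query z = c then 1 else 0) ≤ 1 := by
  rw [sum_weight_mul (fun x => Real.exp (d c / 2 - if x = c then 1 else 0))]
  have h1 : ∀ x, d x * Real.exp (d c / 2 - if x = c then 1 else 0)
      = Real.exp (d c / 2) * (d x + if x = c then d c * (Real.exp (-1) - 1) else 0) := by
    intro x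
    rw [sub_eq_add_neg, Real.exp_add]
    split_ifs with h
    · subst h; ring
    · simp; ring
  simp only [h1]
  rw [← Finset.mul_sum, Finset.sum_add_distrib, hd.2]
  simp only [Finset.sum_ite_eq', Finset.mem_univ, if_true]
  have h2 : 1 + d c * (Real.exp (-1) - 1) ≤ Real.exp (-(d c / 2)) := by
    have := Real.add_one_le_exp (-(d c / 2))
    nlinarith [hd.1 c, exp_neg_one_le_half]
  calc _ ≤ Real.exp (d c / 2) * Real.exp (-(d c / 2)) :=
        mul_le_mul_of_nonneg_left h2 (Real.exp_pos _).le
    _ = 1 := by rw [← Real.exp_add]; simp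

/-- Chernoff bound with a union over the `S A²` comparisons. Being multiplicative in `d c`, it
leaves an additive loss `t` that does not grow with `n`, whence the fast `t / n` term in
`popVar_le_of_count`. -/
theorem dataLaw_count_le {n : ℕ} {d : Fin S × Fin A × Fin A → ℝ} {r : Fin S × Fin A → ℝ}
    (hd : d ∈ stdSimplex ℝ (Fin S × Fin A × Fin A)) (t : ℝ) :
    dataLaw n d r {D | ∃ c, count D c + t ≤ n * d c / 2}
      ≤ ENNReal.ofReal ((S : ℝ) * A ^ 2 * Real.exp (-t)) := by
  refine dataLaw_le_of_one_le hd _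
    (fun D => ∑ c, Real.exp (n * d c / 2 - count D c - t))
    (fun D => Finset.sum_nonneg fun c _ => (Real.exp_pos _).le) ?_ ?_
  · rintro D ⟨c, hc⟩
    calc (1 : ℝ) ≤ Real.exp (n * d c / 2 - count D c - t) := Real.one_le_exp (by linarith)
      _ ≤ _ := Finset.single_le_sum (f := fun c => Real.exp (n * d c / 2 - count D c - t))
          (fun c _ => (Real.exp_pos _).le) (Finset.mem_univ c)
  · simp only [Finset.mul_sum]
    rw [Finset.sum_comm]
    have h : ∀ c, ∑ D : Fin n → Sample S A, (∏ i, weight d r (D i)) *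
        Real.exp (n * d c / 2 - count D c - t) ≤ Real.exp (-t) := by
      intro c
      have h1 : ∀ D : Fin n → Sample S A, (∏ i, weight d r (D i)) *
          Real.exp (n * d c / 2 - count D c - t) = Real.exp (-t) * ∏ i, (weight d r (D i) *
            Real.exp (d c / 2 - if query (D i) = c then 1 else 0)) := by
        intro D
        rw [Finset.prod_mul_distrib, ← Real.exp_sum, Finset.sum_sub_distrib, sub_eq_add_neg,
          Real.exp_add, count]
        simp only [Finset.sum_const, Finset.card_univ, Fintype.card_fin, nsmul_eq_mul]
        rw [mul_div_assoc]; ring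
      simp only [h1]
      rw [← Finset.mul_sum, ← Fintype.piFinset_univ, ← Finset.prod_univ_sum
        (fun _ => Finset.univ) (fun _ z => weight d r z *
            Real.exp (d c / 2 - if query z = c then 1 else 0))]
      rw [Finset.prod_const]
      exact mul_le_of_le_one_right (Real.exp_pos _).le
        (pow_le_one₀ (Finset.sum_nonneg fun z _ =>
          mul_nonneg (weight_nonneg hd z) (Real.exp_pos _).le) (sum_weight_exp_le_one hd c))
    calc _ ≤ ∑ _c : Fin S × Fin A × Fin A, Real.exp (-t) := Finset.sum_le_sum fun c _ => h c
      _ = _ := by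
        simp only [Finset.sum_const, Finset.card_univ, Fintype.card_prod, Fintype.card_fin,
          nsmul_eq_mul, Nat.cast_mul]
        ring

/-! ### Concentration of the score -/

/-- Label noise of a sample. -/
def noise (r : Fin S × Fin A → ℝ) (z : Sample S A) : ℝ :=
  label z.2.2.2 - logistic (gap r (query z))

/-- The reward gaps of `f` on the comparisons `X`, as a linear map of `f`. -/
def gapMap {n : ℕ} (X : Fin n → Fin S × Fin A × Fin A) :
    (Fin S × Fin A → ℝ) →ₗ[ℝ] EuclideanSpace ℝ (Fin n) where
  toFun f := WithLp.toLp 2 fun i => gap f (X i)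
  map_add' f g := by ext i; simp [gap]; ring
  map_smul' c f := by ext i; simp [gap]; ring

theorem sum_btl_exp_noise_le {r : Fin S × Fin A → ℝ} {n : ℕ}
    (X : Fin n → Fin S × Fin A × Fin A) (t : EuclideanSpace ℝ (Fin n)) (l : ℝ) :
    ∑ Y : Fin n → Bool, (∏ i, btl r (X i).1 (X i).2.1 (X i).2.2 (Y i)) *
      Real.exp (l * ∑ i, t i * (label (Y i) - logistic (gap r (X i))))
      ≤ Real.exp (l ^ 2 * ‖t‖ ^ 2 / 2) := by
  have h1 : ∀ Y : Fin n → Bool, (∏ i, btl r (X i).1 (X i).2.1 (X i).2.2 (Y i)) *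
      Real.exp (l * ∑ i, t i * (label (Y i) - logistic (gap r (X i))))
      = ∏ i, (btl r (X i).1 (X i).2.1 (X i).2.2 (Y i) *
        Real.exp (l * t i * (label (Y i) - logistic (gap r (X i))))) := by
    intro Y
    rw [Finset.prod_mul_distrib, ← Real.exp_sum, Finset.mul_sum]
    simp only [mul_assoc]
  simp only [h1]
  rw [← Fintype.piFinset_univ, ← Finset.prod_univ_sum (fun _ => Finset.univ)
    (fun i y => btl r (X i).1 (X i).2.1 (X i).2.2 y *
        Real.exp (l * t i * (label y - logistic (gap r (X i)))))]
  have h2 : l ^ 2 * ‖t‖ ^ 2 / 2 = ∑ i, (l * t i) ^ 2 / 2 := by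
    rw [EuclideanSpace.norm_sq_eq, Finset.mul_sum, Finset.sum_div]
    refine Finset.sum_congr rfl fun i _ => ?_
    rw [Real.norm_eq_abs, sq_abs]; ring
  rw [h2, Real.exp_sum]
  refine Finset.prod_le_prod (fun i _ => Finset.sum_nonneg fun y _ =>
    mul_nonneg (btl_pos _ _ _ _ _).le (Real.exp_pos _).le) fun i _ => ?_
  rw [Fintype.sum_bool, btl_true, btl_false]
  simpa [label] using bernoulli_mgf_le (logistic_pos (gap r (X i))).le
    (logistic_lt_one (gap r (X i))).le (l * t i)

/-- With high probability the noise is nearly orthogonal to all vectors of reward gaps. -/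
theorem dataLaw_score_le {n : ℕ} {d : Fin S × Fin A × Fin A → ℝ} {r : Fin S × Fin A → ℝ}
    (hd : d ∈ stdSimplex ℝ (Fin S × Fin A × Fin A)) {K : ℝ} (hK : 0 ≤ K) :
    dataLaw n d r {D | ∃ v : Fin S × Fin A → ℝ,
        K * Real.sqrt (∑ i, gap v (query (D i)) ^ 2)
          < ∑ i, noise r (D i) * gap v (query (D i))}
      ≤ ENNReal.ofReal (5 ^ (S * A) * Real.exp (-(K ^ 2 / 8))) := by
  -- The net depends on the comparisons only, so it is fixed while the labels are averaged.
  choose T hTc hTb hT using fun X : Fin n → Fin S × Fin A × Fin A =>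
    exists_net_inner_le (LinearMap.range (gapMap X))
  refine dataLaw_le_of_one_le hd _
    -- The Chernoff parameter `l = K / 4` minimizes `2 l² - l K`, the exponent obtained from `‖t‖ ≤
    -- 2`; the minimum is `-K² / 8`.
    (fun D => ∑ t ∈ T (fun i => query (D i)),
      Real.exp (K / 4 * ∑ i, t i * noise r (D i) - K ^ 2 / 4))
    (fun D => Finset.sum_nonneg fun c _ => (Real.exp_pos _).le) ?_ ?_
  · rintro D ⟨v, hv⟩
    have hex : ∃ t ∈ T (fun i => query (D i)), K < ∑ i, t i * noise r (D i) := by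
      by_contra! hcon
      have h := hT (fun i => query (D i)) (WithLp.toLp 2 fun i => noise r (D i)) K
        (fun t ht => by simpa [PiLp.inner_apply] using hcon t ht)
        (gapMap (fun i => query (D i)) v) ⟨v, rfl⟩
      have hn : ‖gapMap (fun i => query (D i)) v‖
          = Real.sqrt (∑ i, gap v (query (D i)) ^ 2) := by
        rw [EuclideanSpace.norm_eq]
        simp [gapMap]
      rw [hn] at h
      have h' : ∑ i, noise r (D i) * gap v (query (D i))
          ≤ K * Real.sqrt (∑ i, gap v (query (D i)) ^ 2) := by
        simpa [PiLp.inner_apply, gapMap, mul_comm] using h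
      linarith
    obtain ⟨t, ht, hKt⟩ := hex
    calc (1 : ℝ) ≤ Real.exp (K / 4 * ∑ i, t i * noise r (D i) - K ^ 2 / 4) :=
          Real.one_le_exp (by nlinarith)
      _ ≤ _ := Finset.single_le_sum
          (f := fun t : EuclideanSpace ℝ (Fin n) =>
            Real.exp (K / 4 * ∑ i, t i * noise r (D i) - K ^ 2 / 4))
          (fun c _ => (Real.exp_pos _).le) ht
  · rw [sum_data]
    have hX : ∀ X : Fin n → Fin S × Fin A × Fin A,
        ∑ Y : Fin n → Bool, (∏ i, btl r (X i).1 (X i).2.1 (X i).2.2 (Y i)) *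
          ∑ t ∈ T X, Real.exp (K / 4 * ∑ i, t i * (label (Y i) - logistic (gap r (X i)))
            - K ^ 2 / 4) ≤ 5 ^ (S * A) * Real.exp (-(K ^ 2 / 8)) := by
      intro X
      simp only [Finset.mul_sum (T X)]
      rw [Finset.sum_comm]
      have ht : ∀ t ∈ T X, ∑ Y : Fin n → Bool,
          (∏ i, btl r (X i).1 (X i).2.1 (X i).2.2 (Y i)) *
          Real.exp (K / 4 * ∑ i, t i * (label (Y i) - logistic (gap r (X i)))
            - K ^ 2 / 4) ≤ Real.exp (-(K ^ 2 / 8)) := by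
        intro t htT
        have h1 := sum_btl_exp_noise_le (r := r) X t (K / 4)
        have h2 : Real.exp ((K / 4) ^ 2 * ‖t‖ ^ 2 / 2) ≤ Real.exp (K ^ 2 / 8) := by
          apply Real.exp_le_exp.2
          have h3 : ‖t‖ ^ 2 ≤ 2 ^ 2 := pow_le_pow_left₀ (norm_nonneg _) (hTb X t htT) 2
          nlinarith [sq_nonneg K]
        simp only [sub_eq_add_neg _ (K ^ 2 / 4), Real.exp_add, ← mul_assoc]
        rw [← Finset.sum_mul]
        calc (∑ Y : Fin n → Bool, (∏ i, btl r (X i).1 (X i).2.1 (X i).2.2 (Y i)) *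
              Real.exp (K / 4 * ∑ i, t i * (label (Y i) - logistic (gap r (X i))))) *
                Real.exp (-(K ^ 2 / 4))
            ≤ Real.exp (K ^ 2 / 8) * Real.exp (-(K ^ 2 / 4)) :=
              mul_le_mul_of_nonneg_right (h1.trans h2) (Real.exp_pos _).le
          _ = Real.exp (-(K ^ 2 / 8)) := by rw [← Real.exp_add]; ring_nf
      calc _ ≤ ∑ _t ∈ T X, Real.exp (-(K ^ 2 / 8)) := Finset.sum_le_sum ht
        _ = (T X).card * Real.exp (-(K ^ 2 / 8)) := by simp
        _ ≤ _ := by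
          refine mul_le_mul_of_nonneg_right ?_ (Real.exp_pos _).le
          have hr : Module.finrank ℝ (LinearMap.range (gapMap X)) ≤ S * A := by
            refine (LinearMap.finrank_range_le _).trans ?_
            simp
          exact_mod_cast (hTc X).trans (Nat.pow_le_pow_right (by norm_num) hr)
    calc _ ≤ ∑ X : Fin n → Fin S × Fin A × Fin A, (∏ i, d (X i)) *
          (5 ^ (S * A) * Real.exp (-(K ^ 2 / 8))) :=
          Finset.sum_le_sum fun X _ =>
            mul_le_mul_of_nonneg_left (hX X) (Finset.prod_nonneg fun i _ => hd.1 _)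
      _ = _ := by rw [← Finset.sum_mul, sum_prod_eq_one hd, one_mul]

/-! ### Quadratic forms of reward gaps -/

theorem gap_sub (f g : Fin S × Fin A → ℝ) (c : Fin S × Fin A × Fin A) :
    gap (f - g) c = gap f c - gap g c := by
  simp only [gap, Pi.sub_apply]; ring

theorem diffVec_dotProduct (v : Fin S × Fin A → ℝ) (z : Sample S A) :
    diffVec z ⬝ᵥ v = -gap v (query z) := by
  rw [diffVec, sub_dotProduct, single_one_dotProduct, single_one_dotProduct]
  simp [gap, query]

theorem dotProduct_empCov_mulVec {n : ℕ} (D : Fin n → Sample S A) (v : Fin S × Fin A → ℝ) :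
    v ⬝ᵥ (empCov D *ᵥ v) = (∑ i, gap v (query (D i)) ^ 2) / n := by
  rw [empCov, smul_mulVec, dotProduct_smul, sum_mulVec, dotProduct_sum, smul_eq_mul,
    one_div_mul_eq_div]
  congr 1
  refine Finset.sum_congr rfl fun i _ => ?_
  rw [vecMulVec_mulVec, diffVec_dotProduct]
  simp [dotProduct_comm v, diffVec_dotProduct]
  ring

/-- Mean squared reward gap under the comparison distribution. -/
def popVar (d : Fin S × Fin A × Fin A → ℝ) (v : Fin S × Fin A → ℝ) : ℝ :=
  ∑ c, d c * gap v c ^ 2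

theorem popVar_eq (d : Fin S × Fin A × Fin A → ℝ) (v : Fin S × Fin A → ℝ) :
    ∑ s, ∑ a0, ∑ a1, d (s, a0, a1) * (v (s, a0) - v (s, a1)) ^ 2 = popVar d v := by
  simp only [popVar, Fintype.sum_prod_type, gap]
  refine Finset.sum_congr rfl fun s _ => Finset.sum_congr rfl fun a _ =>
    Finset.sum_congr rfl fun b _ => ?_
  ring

theorem popVar_nonneg {d : Fin S × Fin A × Fin A → ℝ}
    (hd : d ∈ stdSimplex ℝ (Fin S × Fin A × Fin A)) (v : Fin S × Fin A → ℝ) :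
    0 ≤ popVar d v :=
  Finset.sum_nonneg fun c _ => mul_nonneg (hd.1 c) (sq_nonneg _)

theorem popVar_smul (d : Fin S × Fin A × Fin A → ℝ) (k : ℝ) (v : Fin S × Fin A → ℝ) :
    popVar d (k • v) = k ^ 2 * popVar d v := by
  simp only [popVar, gap, Pi.smul_apply, smul_eq_mul, Finset.mul_sum]
  exact Finset.sum_congr rfl fun c _ => by ring

theorem gap_sq_le {v : Fin S × Fin A → ℝ} {M : ℝ} (hv : ∀ x, |v x| ≤ M)
    (c : Fin S × Fin A × Fin A) : gap v c ^ 2 ≤ 4 * M ^ 2 := by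
  have h1 := abs_le.1 (hv (c.1, c.2.1))
  have h2 := abs_le.1 (hv (c.1, c.2.2))
  have h3 : |gap v c| ≤ 2 * M := by
    rw [abs_le, gap]; constructor <;> linarith [h1.1, h1.2, h2.1, h2.2]
  calc gap v c ^ 2 = |gap v c| ^ 2 := (sq_abs _).symm
    _ ≤ (2 * M) ^ 2 := pow_le_pow_left₀ (abs_nonneg _) h3 2
    _ = _ := by ring

theorem popVar_le {d : Fin S × Fin A × Fin A → ℝ}
    (hd : d ∈ stdSimplex ℝ (Fin S × Fin A × Fin A)) {v : Fin S × Fin A → ℝ} {M : ℝ}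
    (hv : ∀ x, |v x| ≤ M) : popVar d v ≤ 4 * M ^ 2 := by
  calc popVar d v ≤ ∑ c, d c * (4 * M ^ 2) :=
        Finset.sum_le_sum fun c _ => mul_le_mul_of_nonneg_left (gap_sq_le hv c) (hd.1 c)
    _ = _ := by rw [← Finset.sum_mul, hd.2, one_mul]

theorem sum_count_mul {n : ℕ} (D : Fin n → Sample S A) (g : Fin S × Fin A × Fin A → ℝ) :
    ∑ c, count D c * g c = ∑ i, g (query (D i)) := by
  simp only [count, Finset.sum_mul]
  rw [Finset.sum_comm]
  refine Finset.sum_congr rfl fun i _ => ?_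
  simp

/-- The population mean squared gap is controlled by the empirical one. -/
theorem popVar_le_of_count {n : ℕ} (hn : 0 < n) {D : Fin n → Sample S A}
    {d : Fin S × Fin A × Fin A → ℝ} {t : ℝ} (ht : 0 ≤ t)
    (hc : ∀ c, n * d c / 2 < count D c + t) {v : Fin S × Fin A → ℝ} {M : ℝ}
    (hv : ∀ x, |v x| ≤ M) :
    popVar d v ≤ 2 * ((∑ i, gap v (query (D i)) ^ 2) / n)
      + 8 * M ^ 2 * ((S : ℝ) * A ^ 2 * t / n) := by
  have hn' : (0 : ℝ) < n := by exact_mod_cast hn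
  -- The count bound makes `d c` at most twice the empirical frequency plus `2 t / n`; the latter is
  -- summed against the crude bound on squared gaps.
  have h1 : ∀ c, d c ≤ 2 / n * (count D c + t) := fun c => by
    rw [div_mul_eq_mul_div, le_div_iff₀ hn']
    linarith [hc c]
  calc popVar d v ≤ ∑ c, 2 / n * (count D c + t) * gap v c ^ 2 :=
        Finset.sum_le_sum fun c _ => mul_le_mul_of_nonneg_right (h1 c) (sq_nonneg _)
    _ = 2 / n * (∑ i, gap v (query (D i)) ^ 2) + 2 / n * t * ∑ c, gap v c ^ 2 := by
        rw [← sum_count_mul D fun c => gap v c ^ 2, Finset.mul_sum, Finset.mul_sum,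
          ← Finset.sum_add_distrib]
        exact Finset.sum_congr rfl fun c _ => by ring
    _ ≤ 2 / n * (∑ i, gap v (query (D i)) ^ 2) + 2 / n * t * ((S : ℝ) * A ^ 2 * (4 * M ^ 2)) := by
        have h2 : ∑ c, gap v c ^ 2 ≤ (S : ℝ) * A ^ 2 * (4 * M ^ 2) := by
          calc ∑ c, gap v c ^ 2 ≤ ∑ _c : Fin S × Fin A × Fin A, 4 * M ^ 2 :=
                Finset.sum_le_sum fun c _ => gap_sq_le hv c
            _ = _ := by
              simp only [Finset.sum_const, Finset.card_univ, Fintype.card_prod, Fintype.card_fin,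
                nsmul_eq_mul, Nat.cast_mul]
              ring
        have : 0 ≤ 2 / n * t := by positivity
        linarith [mul_le_mul_of_nonneg_left h2 this]
    _ = _ := by ring

/-! ### Estimation error of the maximum likelihood estimate -/

theorem log_btl (f : Fin S × Fin A → ℝ) (z : Sample S A) :
    Real.log (btl f z.1 z.2.1 z.2.2.1 z.2.2.2)
      = label z.2.2.2 * gap f (query z) - Real.log (1 + Real.exp (gap f (query z))) := by
  obtain ⟨s, a0, a1, y⟩ := z
  cases y
  · simp only [btl_false, one_sub_logistic, label, query]
    rw [Real.log_div one_ne_zero (by positivity)]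
    simp
  · simp only [btl_true, logistic, label, query]
    rw [Real.log_div (by positivity) (by positivity)]
    simp

/-- The reward shifted to have mean zero. -/
def centered (r : Fin S × Fin A → ℝ) : Fin S × Fin A → ℝ :=
  fun x => r x - (∑ y, r y) / ((S : ℝ) * A)

theorem gap_centered (r : Fin S × Fin A → ℝ) (c : Fin S × Fin A × Fin A) :
    gap (centered r) c = gap r c := by
  simp only [gap, centered]; ring

theorem centered_mem_rewardClass {R : ℝ} {r : Fin S × Fin A → ℝ}
    (hr : ∀ x, r x ∈ Set.Icc 0 R) (hSA : 0 < (S : ℝ) * A) :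
    centered r ∈ rewardClass S A R := by
  constructor
  · simp only [centered, Finset.sum_sub_distrib, Finset.sum_const, Finset.card_univ,
      Fintype.card_prod, Fintype.card_fin, nsmul_eq_mul, Nat.cast_mul]
    rw [mul_div_cancel₀ _ hSA.ne', sub_self]
  · intro x
    have h0 : 0 ≤ (∑ y, r y) / ((S : ℝ) * A) :=
      div_nonneg (Finset.sum_nonneg fun y _ => (hr y).1) hSA.le
    have h1 : (∑ y, r y) / ((S : ℝ) * A) ≤ R := by
      rw [div_le_iff₀ hSA]
      calc ∑ y, r y ≤ ∑ _y : Fin S × Fin A, R := Finset.sum_le_sum fun y _ => (hr y).2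
        _ = _ := by simp; ring
    have := hr x
    rw [abs_le, centered]
    constructor <;> linarith [this.1, this.2]

/-- Basic inequality of maximum likelihood: optimality of `rt` bounds the summed Bregman divergences
by the noise paired with the gap error. The divergences are at least quadratic and the noise term at
most `K` times the norm, so one factor of the norm cancels. -/
theorem mle_error_le {n : ℕ} {R K : ℝ} {r rt : Fin S × Fin A → ℝ} {D : Fin n → Sample S A}
    (hr : ∀ x, r x ∈ Set.Icc 0 R) (hSA : 0 < (S : ℝ) * A) (hrt : IsMLE R D rt) (hK : 0 ≤ K)
    (hscore : ∀ v : Fin S × Fin A → ℝ, ∑ i, noise r (D i) * gap v (query (D i))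
      ≤ K * Real.sqrt (∑ i, gap v (query (D i)) ^ 2)) :
    Real.exp (-(7 / 5 * R)) / 32 *
      Real.sqrt (∑ i, gap (centered r - rt) (query (D i)) ^ 2) ≤ K := by
  have hlik := hrt.2 _ (centered_mem_rewardClass hr hSA)
  have hb : ∀ i, Real.exp (-(7 / 5 * R)) / 32 * gap (rt - centered r) (query (D i)) ^ 2 ≤
      Real.log (1 + Real.exp (gap rt (query (D i))))
        - Real.log (1 + Real.exp (gap r (query (D i))))
        - logistic (gap r (query (D i))) * gap (rt - centered r) (query (D i)) := by
    intro i
    rw [gap_sub, gap_centered]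
    have h1 := hr ((query (D i)).1, (query (D i)).2.1)
    have h2 := hr ((query (D i)).1, (query (D i)).2.2)
    have h3 := abs_le.1 (hrt.1.2 ((query (D i)).1, (query (D i)).2.1))
    have h4 := abs_le.1 (hrt.1.2 ((query (D i)).1, (query (D i)).2.2))
    apply bregman_lower
    · rw [abs_le, gap]; constructor <;> linarith [h1.1, h1.2, h2.1, h2.2]
    · rw [abs_le, gap, gap]
      constructor <;> linarith [h1.1, h1.2, h2.1, h2.2, h3.1, h3.2, h4.1, h4.2]
  have hsum := Finset.sum_le_sum fun i (_ : i ∈ Finset.univ) => hb i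
  rw [← Finset.mul_sum] at hsum
  have hle : Real.exp (-(7 / 5 * R)) / 32 * ∑ i, gap (rt - centered r) (query (D i)) ^ 2
      ≤ ∑ i, noise r (D i) * gap (rt - centered r) (query (D i)) := by
    have h1 : ∑ i, (Real.log (1 + Real.exp (gap rt (query (D i))))
        - Real.log (1 + Real.exp (gap r (query (D i))))
        - logistic (gap r (query (D i))) * gap (rt - centered r) (query (D i)))
        = ∑ i, noise r (D i) * gap (rt - centered r) (query (D i))
          + (logLik D (centered r) - logLik D rt) := by
      simp only [logLik, log_btl, noise]
      rw [← Finset.sum_sub_distrib, ← Finset.sum_add_distrib]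
      refine Finset.sum_congr rfl fun i _ => ?_
      rw [gap_sub, gap_centered]; ring
    linarith
  have hswap : ∀ i, gap (rt - centered r) (query (D i)) ^ 2
      = gap (centered r - rt) (query (D i)) ^ 2 := fun i => by
    rw [gap_sub, gap_sub]; ring
  have hfin := hle.trans (hscore (rt - centered r))
  simp only [hswap] at hfin
  set Q := ∑ i, gap (centered r - rt) (query (D i)) ^ 2 with hQ
  have hQ0 : 0 ≤ Q := Finset.sum_nonneg fun i _ => sq_nonneg _
  rcases hQ0.eq_or_lt with h0 | h0
  · rw [← h0, Real.sqrt_zero, mul_zero]; exact hK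
  · have hs : 0 < Real.sqrt Q := Real.sqrt_pos.2 h0
    have h2 := Real.mul_self_sqrt hQ0
    refine le_of_mul_le_mul_right ?_ hs
    rwa [mul_assoc, h2]

/-! ### Concentrability -/

theorem avgValue_eq (ρ : Fin S → ℝ) (f : Fin S × Fin A → ℝ) (π : Fin S → Fin A → ℝ) :
    avgValue ρ f π = ∑ x, visit ρ π x * f x := by
  simp only [avgValue, value, visit, Fintype.sum_prod_type, Finset.mul_sum, mul_assoc]

theorem abs_sum_visit_le {ρ : Fin S → ℝ} {d : Fin S × Fin A × Fin A → ℝ}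
    {π : Fin S → Fin A → ℝ} (hC : Cdagger ρ d π ≠ ⊤) {v : Fin S × Fin A → ℝ}
    (hd : d ∈ stdSimplex ℝ (Fin S × Fin A × Fin A)) (hv : ∑ x, v x = 0) :
    |∑ x, visit ρ π x * v x| ≤ (Cdagger ρ d π).toReal * Real.sqrt (popVar d v) := by
  set C2 : ENNReal := ⨆ v ∈ {v : Fin S × Fin A → ℝ |
      (∀ x, v x ∈ Set.Icc (-1 : ℝ) 1) ∧ ∑ x, v x = 0},
    ENNReal.ofReal ((∑ x, visit ρ π x * v x) ^ 2) /
      ENNReal.ofReal (∑ s, ∑ a0, ∑ a1, d (s, a0, a1) * (v (s, a0) - v (s, a1)) ^ 2) with hC2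
  have hCd : Cdagger ρ d π = C2 ^ (1 / 2 : ℝ) := rfl
  have hC2t : C2 ≠ ⊤ := fun h => hC (by rw [hCd, h, ENNReal.top_rpow_of_pos (by norm_num)])
  have hCr : (Cdagger ρ d π).toReal = Real.sqrt C2.toReal := by
    rw [hCd, ← ENNReal.toReal_rpow, Real.sqrt_eq_rpow]
  have hunit : ∀ u : Fin S × Fin A → ℝ, (∀ x, |u x| ≤ 1) → ∑ x, u x = 0 →
      (∑ x, visit ρ π x * u x) ^ 2 ≤ C2.toReal * popVar d u := by
    intro u hu hu0
    have h1 : ENNReal.ofReal ((∑ x, visit ρ π x * u x) ^ 2) / ENNReal.ofReal (popVar d u)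
        ≤ C2 := by
      rw [← popVar_eq, hC2]
      exact le_iSup₂ (f := fun (v : Fin S × Fin A → ℝ) (_ : v ∈ {v : Fin S × Fin A → ℝ |
          (∀ x, v x ∈ Set.Icc (-1 : ℝ) 1) ∧ ∑ x, v x = 0}) =>
        ENNReal.ofReal ((∑ x, visit ρ π x * v x) ^ 2) /
          ENNReal.ofReal (∑ s, ∑ a0, ∑ a1, d (s, a0, a1) * (v (s, a0) - v (s, a1)) ^ 2))
        u ⟨fun x => abs_le.1 (hu x), hu0⟩
    -- Finiteness of the supremum covers a zero denominator: a positive numerator over it would be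
    -- `⊤`.
    rw [ENNReal.div_le_iff_le_mul (Or.inr hC2t) (Or.inl ENNReal.ofReal_ne_top)] at h1
    have h2 := ENNReal.toReal_mono (ENNReal.mul_ne_top hC2t ENNReal.ofReal_ne_top) h1
    rwa [ENNReal.toReal_mul, ENNReal.toReal_ofReal (sq_nonneg _),
      ENNReal.toReal_ofReal (popVar_nonneg hd u)] at h2
  -- Both sides are homogeneous in `v`, so `v` may be scaled into the unit cube; the `1 +` keeps the
  -- divisor positive when `v = 0`.
  set M := 1 + ∑ x, |v x| with hM
  have hs0 : 0 ≤ ∑ x, |v x| := Finset.sum_nonneg fun x _ => abs_nonneg _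
  have hM0 : 0 < M := by linarith
  have h := hunit (M⁻¹ • v) (fun x => by
      have := Finset.single_le_sum (f := fun x => |v x|) (fun x _ => abs_nonneg _)
        (Finset.mem_univ x)
      rw [Pi.smul_apply, smul_eq_mul, abs_mul, abs_of_pos (inv_pos.2 hM0), inv_mul_le_iff₀ hM0]
      linarith) (by
      simp only [Pi.smul_apply, smul_eq_mul]
      rw [← Finset.mul_sum, hv, mul_zero])
  have hlin : ∑ x, visit ρ π x * (M⁻¹ • v) x = M⁻¹ * ∑ x, visit ρ π x * v x := by
    rw [Finset.mul_sum]
    exact Finset.sum_congr rfl fun x _ => by simp; ring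
  rw [hlin, popVar_smul, mul_pow, mul_left_comm] at h
  have h' := le_of_mul_le_mul_left h (by positivity)
  rw [hCr, ← Real.sqrt_mul ENNReal.toReal_nonneg, ← Real.sqrt_sq_eq_abs]
  exact Real.sqrt_le_sqrt h'

/-! ### Pessimism -/

theorem avgValue_centered {ρ : Fin S → ℝ} (r : Fin S × Fin A → ℝ) {π : Fin S → Fin A → ℝ}
    (hπ : IsPolicy π) (hρ : ρ ∈ stdSimplex ℝ (Fin S)) :
    avgValue ρ (centered r) π = avgValue ρ r π - (∑ y, r y) / ((S : ℝ) * A) := by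
  have h : ∀ s, value (centered r) π s = value r π s - (∑ y, r y) / ((S : ℝ) * A) := fun s => by
    simp only [value, centered, mul_sub, Finset.sum_sub_distrib]
    rw [← Finset.sum_mul, (hπ s).2, one_mul]
  simp only [avgValue, h, mul_sub, Finset.sum_sub_distrib]
  rw [← Finset.sum_mul, hρ.2, one_mul]

theorem subOpt_eq {ρ : Fin S → ℝ} (r : Fin S × Fin A → ℝ) {πstar π : Fin S → Fin A → ℝ}
    (hs : IsPolicy πstar) (hπ : IsPolicy π) (hρ : ρ ∈ stdSimplex ℝ (Fin S)) :
    subOpt ρ r πstar π = avgValue ρ (centered r) πstar - avgValue ρ (centered r) π := by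
  rw [avgValue_centered r hs hρ, avgValue_centered r hπ hρ]
  simp only [subOpt, avgValue, mul_sub, Finset.sum_sub_distrib]
  ring

theorem neg_le_avgValue {ρ : Fin S → ℝ} {f : Fin S × Fin A → ℝ} {π : Fin S → Fin A → ℝ} {R : ℝ}
    (hπ : IsPolicy π) (hρ : ρ ∈ stdSimplex ℝ (Fin S)) (hf : ∀ x, |f x| ≤ R) :
    -R ≤ avgValue ρ f π := by
  have h : ∀ s, -R ≤ value f π s := fun s => by
    calc -R = ∑ a, π s a * -R := by rw [← Finset.sum_mul, (hπ s).2, one_mul]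
      _ ≤ _ := Finset.sum_le_sum fun a _ =>
        mul_le_mul_of_nonneg_left (abs_le.1 (hf _)).1 ((hπ s).1 a)
  calc -R = ∑ s, ρ s * -R := by rw [← Finset.sum_mul, hρ.2, one_mul]
    _ ≤ _ := Finset.sum_le_sum fun s _ => mul_le_mul_of_nonneg_left (h s) (hρ.1 s)

/-- If the true reward lies in the confidence set, the pessimistic policy loses at most the
width of the confidence set in the direction of the optimal policy. -/
theorem subOpt_le_of_mem_confSet {n : ℕ} {ρ : Fin S → ℝ} {R b Q : ℝ} {D : Fin n → Sample S A}
    {r rt : Fin S × Fin A → ℝ} {πstar π : Fin S → Fin A → ℝ}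
    (hs : IsPolicy πstar) (hπ : IsPolicy π) (hρ : ρ ∈ stdSimplex ℝ (Fin S))
    (hopt : ∀ π', IsPolicy π' → pessValue ρ R b D rt π' ≤ pessValue ρ R b D rt π)
    (hmem : centered r ∈ confSet R b D rt)
    (hQ : ∀ f ∈ confSet R b D rt, avgValue ρ (centered r) πstar - avgValue ρ f πstar ≤ Q) :
    subOpt ρ r πstar π ≤ Q := by
  have h1 : pessValue ρ R b D rt π ≤ avgValue ρ (centered r) π := by
    -- The lower bound `-R` makes the real `sInf` a genuine infimum.
    refine csInf_le ⟨-R, ?_⟩ ⟨_, hmem, rfl⟩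
    rintro _ ⟨f, hf, rfl⟩
    exact neg_le_avgValue hπ hρ hf.1.2
  have h2 : avgValue ρ (centered r) πstar - Q ≤ pessValue ρ R b D rt πstar := by
    refine le_csInf ⟨_, _, hmem, rfl⟩ ?_
    rintro _ ⟨f, hf, rfl⟩
    linarith [hQ f hf]
  rw [subOpt_eq r hs hπ hρ]
  linarith [hopt πstar hs]

/-! ### The rates -/

theorem gam_pos (S A : ℕ) (R : ℝ) : 0 < gam S A R := by unfold gam; positivity

theorem gam_le_quarter (S A : ℕ) (R : ℝ) : gam S A R ≤ 1 / 4 := by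
  unfold gam
  apply div_le_div_of_nonneg_left zero_le_one (by norm_num)
  have := Real.one_le_cosh (R * Real.sqrt ((S : ℝ) * A))
  rw [Real.cosh_eq] at this
  linarith

theorem gam_le_exp {S A : ℕ} {R : ℝ} (hR : 0 ≤ R) (hSA : 2 ≤ (S : ℝ) * A) :
    gam S A R ≤ Real.exp (-(7 / 5 * R)) := by
  have h1 : 7 / 5 ≤ Real.sqrt ((S : ℝ) * A) := Real.le_sqrt_of_sq_le (by linarith)
  have h2 : 7 / 5 * R ≤ R * Real.sqrt ((S : ℝ) * A) := by nlinarith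
  rw [gam, Real.exp_neg (7 / 5 * R), inv_eq_one_div]
  apply div_le_div_of_nonneg_left zero_le_one (Real.exp_pos _)
  have := Real.exp_le_exp.2 h2
  linarith [Real.exp_pos (-(R * Real.sqrt ((S : ℝ) * A)))]

theorem mleRate_eq (S A : ℕ) (R δ : ℝ) (n : ℕ) :
    mleRate S A R δ n
      = Real.sqrt ((S : ℝ) * A + Real.log (1 / δ)) / gam S A R / Real.sqrt n := by
  rw [mleRate, Real.sqrt_div' _ (by positivity), Real.sqrt_mul (by positivity),
    Real.sqrt_sq (gam_pos S A R).le, div_div]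

/-- Regime `n ≤ SA`: since `γ ≤ 1/4`, the rate is so large that the bound in `popVar_le_rates` holds
for trivial reasons. -/
theorem four_le_mleRate {S A n : ℕ} {R δ : ℝ} (hn : 0 < n) (hδ : 0 ≤ Real.log (1 / δ))
    (hnSA : (n : ℝ) ≤ (S : ℝ) * A) : 4 ≤ mleRate S A R δ n := by
  have hn' : (0 : ℝ) < n := by exact_mod_cast hn
  have hg := gam_pos S A R
  have hg2 : gam S A R ^ 2 ≤ (1 / 4) ^ 2 := pow_le_pow_left₀ hg.le (gam_le_quarter S A R) 2
  apply Real.le_sqrt_of_sq_le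
  rw [le_div_iff₀ (by positivity)]
  nlinarith

/-- In the regime `SA ≤ n`, the union-bound factor satisfies `2 S A² ≤ 2 n² ≤ n³`, so its logarithm
is absorbed into `log (n/δ)`. -/
theorem log_le_three_mul_log {S A n : ℕ} {δ : ℝ} (hδ0 : 0 < δ) (hδ : 0 ≤ Real.log (1 / δ))
    (hSA : 2 ≤ (S : ℝ) * A) (hnSA : (S : ℝ) * A ≤ n) :
    Real.log (2 * (S * A ^ 2) / δ) ≤ 3 * Real.log (n / δ) := by
  have hS : (1 : ℝ) ≤ S := by
    rcases Nat.eq_zero_or_pos S with h | h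
    · subst h; norm_num at hSA
    · exact_mod_cast h
  have hA : (1 : ℝ) ≤ A := by
    rcases Nat.eq_zero_or_pos A with h | h
    · subst h; norm_num at hSA
    · exact_mod_cast h
  have hn : (0 : ℝ) < n := by linarith
  have h1 : 2 * ((S : ℝ) * A ^ 2) ≤ (n : ℝ) ^ 3 := by
    have h2 : (S : ℝ) * A ^ 2 ≤ (S * A) ^ 2 := by
      rw [mul_pow]; exact mul_le_mul_of_nonneg_right (by nlinarith) (by positivity)
    have h3 : ((S : ℝ) * A) ^ 2 ≤ (n : ℝ) ^ 2 := pow_le_pow_left₀ (by positivity) hnSA 2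
    nlinarith
  have h4 := Real.log_le_log (by positivity) h1
  rw [Real.log_pow] at h4
  rw [one_div, Real.log_inv] at hδ
  rw [Real.log_div (by positivity) hδ0.ne', Real.log_div hn.ne' hδ0.ne']
  push_cast at h4
  linarith

theorem popVar_le_rates {S A n : ℕ} {R δ : ℝ} {D : Fin n → Sample S A}
    {d : Fin S × Fin A × Fin A → ℝ} {v : Fin S × Fin A → ℝ}
    (hd : d ∈ stdSimplex ℝ (Fin S × Fin A × Fin A))
    (hR : 0 ≤ R) (hn : 0 < n) (hδ0 : 0 < δ) (hδ : 0 ≤ Real.log (1 / δ))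
    (hSA : 2 ≤ (S : ℝ) * A) (hv : ∀ x, |v x| ≤ 2 * R)
    (hc : ∀ c, n * d c / 2 < count D c + Real.log (2 * (S * A ^ 2) / δ))
    (ht : 0 ≤ Real.log (2 * ((S : ℝ) * A ^ 2) / δ))
    (hemp : (∑ i, gap v (query (D i)) ^ 2) / n ≤ 4 * (256 * mleRate S A R δ n) ^ 2) :
    Real.sqrt (popVar d v)
      ≤ 1000 * (max R 1 * mleRate S A R δ n + R * covRate S A δ n) := by
  have hn' : (0 : ℝ) < n := by exact_mod_cast hn
  have hm0 : 0 ≤ mleRate S A R δ n := Real.sqrt_nonneg _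
  have hc0 : 0 ≤ covRate S A δ n := Real.sqrt_nonneg _
  have hmax : 1 ≤ max R 1 := le_max_right _ _
  have hmaxR : R ≤ max R 1 := le_max_left _ _
  have hmm : mleRate S A R δ n ≤ max R 1 * mleRate S A R δ n :=
    le_mul_of_one_le_left hm0 hmax
  have hrc : 0 ≤ R * covRate S A δ n := mul_nonneg hR hc0
  apply Real.sqrt_le_left (by positivity) |>.2
  rcases le_total (n : ℝ) ((S : ℝ) * A) with hcase | hcase
  · have h4 := four_le_mleRate (R := R) hn hδ hcase
    have h1 := popVar_le hd hv
    have h2 : 4 * R ≤ max R 1 * mleRate S A R δ n := by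
      rw [mul_comm]; exact mul_le_mul hmaxR h4 (by norm_num) (by linarith)
    have h3 : 4 * R ≤ 1000 * (max R 1 * mleRate S A R δ n + R * covRate S A δ n) := by
      linarith
    have h5 := pow_le_pow_left₀ (by positivity) h3 2
    nlinarith
  · have h1 := popVar_le_of_count hn ht hc hv
    have hlog := log_le_three_mul_log hδ0 hδ hSA hcase
    have hlog0 : 0 ≤ Real.log (n / δ) := by linarith
    have hcov : covRate S A δ n ^ 2 = (S : ℝ) ^ 2 * (A : ℝ) ^ 2 * Real.log (n / δ) / n :=
      Real.sq_sqrt (by positivity)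
    have hS2 : (S : ℝ) * A ^ 2 ≤ (S : ℝ) ^ 2 * A ^ 2 := by
      have : (S : ℝ) ≤ (S : ℝ) ^ 2 := by exact_mod_cast Nat.le_self_pow two_ne_zero S
      exact mul_le_mul_of_nonneg_right this (by positivity)
    have h2 : (S : ℝ) * A ^ 2 * Real.log (2 * (S * A ^ 2) / δ) / n
        ≤ 3 * covRate S A δ n ^ 2 := by
      rw [hcov, mul_div_assoc', div_le_div_iff_of_pos_right hn']
      calc _ ≤ (S : ℝ) ^ 2 * A ^ 2 * (3 * Real.log (n / δ)) :=
            mul_le_mul hS2 hlog ht (by positivity)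
        _ = _ := by ring
    have h3 := mul_le_mul_of_nonneg_left h2 (by positivity : 0 ≤ 8 * (2 * R) ^ 2)
    -- Here `524288 = 2 * 4 * 256 ^ 2` and `96 = 3 * 8 * 2 ^ 2`; both are below `1000 ^ 2`.
    have h5 : popVar d v ≤ 524288 * mleRate S A R δ n ^ 2 + 96 * (R * covRate S A δ n) ^ 2 := by
      nlinarith
    have h6 : mleRate S A R δ n ^ 2 ≤ (max R 1 * mleRate S A R δ n) ^ 2 :=
      pow_le_pow_left₀ hm0 hmm 2
    nlinarith [mul_nonneg (hm0.trans hmm) hrc, sq_nonneg (R * covRate S A δ n),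
      sq_nonneg (mleRate S A R δ n)]

/-- A comparison with positive mass involves two distinct actions. -/
theorem two_le_card_of_mem_stdSimplex {S A : ℕ} {d : Fin S × Fin A × Fin A → ℝ}
    (hd : d ∈ stdSimplex ℝ (Fin S × Fin A × Fin A)) (hne : ∀ s a, d (s, a, a) = 0) :
    2 ≤ (S : ℝ) * A := by
  have hex : ∃ c, d c ≠ 0 := by
    by_contra! h
    have := hd.2
    simp [h] at this
  obtain ⟨⟨s, a, b⟩, hc⟩ := hex
  have hab : a ≠ b := fun h => hc (by rw [h]; exact hne s b)
  have hS : 1 ≤ S := s.pos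
  have hA : 2 ≤ A := by
    have h1 := a.isLt
    have h2 := b.isLt
    have h3 : (a : ℕ) ≠ b := fun h => hab (Fin.ext h)
    omega
  have := Nat.mul_le_mul hS hA
  rw [one_mul] at this
  exact_mod_cast this

theorem score_tail_le {S A : ℕ} {δ : ℝ} (hδ0 : 0 < δ) (hδ : 0 ≤ Real.log (1 / δ))
    (hSA : 2 ≤ (S : ℝ) * A) :
    5 ^ (S * A) * Real.exp (-((8 * Real.sqrt ((S : ℝ) * A + Real.log (1 / δ))) ^ 2 / 8))
      ≤ δ / 2 := by
  rw [mul_pow, Real.sq_sqrt (by linarith)]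
  have h5 : (5 : ℝ) ^ (S * A) ≤ Real.exp (4 * ((S : ℝ) * A)) := by
    have h := pow_le_pow_left₀ (by norm_num) (Real.add_one_le_exp 4) (S * A)
    rw [← Real.exp_nat_mul] at h
    push_cast at h
    rw [mul_comm 4]
    norm_num at h
    exact h
  have hlog : Real.exp (-Real.log (1 / δ)) = δ := by
    rw [one_div, Real.log_inv, neg_neg, Real.exp_log hδ0]
  calc _ ≤ Real.exp (4 * ((S : ℝ) * A)) *
        Real.exp (-(8 ^ 2 * ((S : ℝ) * A + Real.log (1 / δ)) / 8)) :=
        mul_le_mul_of_nonneg_right h5 (Real.exp_pos _).le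
    -- The exponent is `4 SA - 8 (SA + log (1/δ))`, and `4 SA ≥ 1` supplies the factor `e⁻¹ ≤ 1/2`.
    _ ≤ Real.exp (-Real.log (1 / δ)) * Real.exp (-1) := by
        rw [← Real.exp_add, ← Real.exp_add]
        apply Real.exp_le_exp.2
        linarith
    _ ≤ δ / 2 := by
        rw [hlog]
        linarith [mul_le_mul_of_nonneg_left exp_neg_one_le_half hδ0.le]

theorem subOpt_le_of_concentration {S A n : ℕ} {R δ : ℝ} {D : Fin n → Sample S A}
    {r : Fin S × Fin A → ℝ} {ρ : Fin S → ℝ} {d : Fin S × Fin A × Fin A → ℝ}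
    {πstar π : Fin S → Fin A → ℝ}
    (hr : ∀ x, r x ∈ Set.Icc 0 R) (hρ : ρ ∈ stdSimplex ℝ (Fin S))
    (hd : d ∈ stdSimplex ℝ (Fin S × Fin A × Fin A)) (hs : IsPolicy πstar)
    (hC : Cdagger ρ d πstar ≠ ⊤) (hR : 0 ≤ R) (hn : 0 < n) (hδ0 : 0 < δ)
    (hδ : 0 ≤ Real.log (1 / δ)) (hSA : 2 ≤ (S : ℝ) * A)
    (hscore : ∀ v : Fin S × Fin A → ℝ, ∑ i, noise r (D i) * gap v (query (D i))
      ≤ 8 * Real.sqrt ((S : ℝ) * A + Real.log (1 / δ)) *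
        Real.sqrt (∑ i, gap v (query (D i)) ^ 2))
    (hc : ∀ c, n * d c / 2 < count D c + Real.log (2 * (S * A ^ 2) / δ))
    (ht : 0 ≤ Real.log (2 * ((S : ℝ) * A ^ 2) / δ))
    (hπ : IsPMLEOutput ρ R (256 * mleRate S A R δ n) D π) :
    subOpt ρ r πstar π ≤ 1000 * (Cdagger ρ d πstar).toReal *
      (max R 1 * mleRate S A R δ n + R * covRate S A δ n) := by
  obtain ⟨rt, hrt, hpol, hopt⟩ := hπ
  have hn' : (0 : ℝ) < n := by exact_mod_cast hn
  have hSA0 : 0 < (S : ℝ) * A := by linarith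
  have hcen := centered_mem_rewardClass hr hSA0
  have hmem : centered r ∈ confSet R (256 * mleRate S A R δ n) D rt := by
    refine ⟨hcen, ?_⟩
    -- The radius constant is `256 = 32 * 8`: `1/32` from the strong convexity constant and `8` from
    -- the score bound. The remaining `exp (-(7/5 R))` is at least `γ`.
    have h1 := mle_error_le hr hSA0 hrt (by positivity) hscore
    rw [dotProduct_empCov_mulVec, Real.sqrt_div' _ hn'.le, mleRate_eq, mul_div_assoc',
      div_le_div_iff_of_pos_right (Real.sqrt_pos.2 hn'), mul_div_assoc',
      le_div_iff₀ (gam_pos S A R)]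
    have h2 := mul_le_mul_of_nonneg_right (gam_le_exp hR hSA)
      (Real.sqrt_nonneg (∑ i, gap (centered r - rt) (query (D i)) ^ 2))
    linarith
  refine subOpt_le_of_mem_confSet hs hpol hρ hopt hmem fun f hf => ?_
  have hm0 : 0 ≤ mleRate S A R δ n := Real.sqrt_nonneg _
  have hemp : ∀ g ∈ confSet R (256 * mleRate S A R δ n) D rt,
      (∑ i, gap (g - rt) (query (D i)) ^ 2) / n ≤ (256 * mleRate S A R δ n) ^ 2 := by
    intro g hg
    rw [← dotProduct_empCov_mulVec]
    exact (Real.sqrt_le_left (by positivity)).1 hg.2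
  -- Both rewards lie within the radius of `rt`, so their squared distance is at most four squared
  -- radii.
  have hemp' : (∑ i, gap (centered r - f) (query (D i)) ^ 2) / n
      ≤ 4 * (256 * mleRate S A R δ n) ^ 2 := by
    have h1 : ∑ i, gap (centered r - f) (query (D i)) ^ 2
        ≤ 2 * ∑ i, gap (centered r - rt) (query (D i)) ^ 2
          + 2 * ∑ i, gap (f - rt) (query (D i)) ^ 2 := by
      rw [Finset.mul_sum, Finset.mul_sum, ← Finset.sum_add_distrib]
      refine Finset.sum_le_sum fun i _ => ?_
      simp only [gap_sub]
      nlinarith [sq_nonneg (gap (centered r) (query (D i)) - gap rt (query (D i))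
        + (gap f (query (D i)) - gap rt (query (D i))))]
    have h2 := div_le_div_of_nonneg_right h1 hn'.le
    rw [add_div, mul_div_assoc, mul_div_assoc] at h2
    linarith [hemp _ hmem, hemp _ hf]
  have hv : ∀ x, |(centered r - f) x| ≤ 2 * R := fun x => by
    have h1 := abs_sub (centered r x) (f x)
    rw [Pi.sub_apply]
    linarith [hcen.2 x, hf.1.2 x]
  have hv0 : ∑ x, (centered r - f) x = 0 := by
    simp only [Pi.sub_apply, Finset.sum_sub_distrib]
    rw [hcen.1, hf.1.1, sub_self]
  have hlin : avgValue ρ (centered r) πstar - avgValue ρ f πstar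
      = ∑ x, visit ρ πstar x * (centered r - f) x := by
    rw [avgValue_eq, avgValue_eq, ← Finset.sum_sub_distrib]
    exact Finset.sum_congr rfl fun x _ => by rw [Pi.sub_apply]; ring
  rw [hlin]
  have h1 := (le_abs_self _).trans (abs_sum_visit_le hC hd hv0)
  have h2 := popVar_le_rates hd hR hn hδ0 hδ hSA hv hc ht hemp'
  calc _ ≤ _ := h1
    _ ≤ _ := mul_le_mul_of_nonneg_left h2 ENNReal.toReal_nonneg
    _ = _ := by ring

end PrefBandit

end

theorem theorem4 :
    ∃ cb : ℝ, 0 < cb ∧ ∃ c0 : ℝ, 0 < c0 ∧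
      ∀ (S A : ℕ) (R : ℝ)
        (r : Fin S × Fin A → ℝ) (_ : ∀ x, r x ∈ Set.Icc 0 R)
        (ρ : Fin S → ℝ) (_ : ρ ∈ stdSimplex ℝ (Fin S))
        (d : Fin S × Fin A × Fin A → ℝ) (_ : d ∈ stdSimplex ℝ (Fin S × Fin A × Fin A))
        (_ : ∀ s a, d (s, a, a) = 0)
        (πstar : Fin S → Fin A → ℝ) (_ : PrefBandit.IsOptimal r πstar)
        (_ : PrefBandit.Cdagger ρ d πstar ≠ ⊤)
        (δ : ℝ) (_ : 0 < δ) (_ : δ < 1)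
        (n : ℕ) (_ : 0 < n),
        ENNReal.ofReal (1 - δ) ≤
          PrefBandit.dataLaw n d r
            {D | ∀ π, PrefBandit.IsPMLEOutput ρ R (cb * PrefBandit.mleRate S A R δ n) D π →
              PrefBandit.subOpt ρ r πstar π ≤
                c0 * (PrefBandit.Cdagger ρ d πstar).toReal *
                  (max R 1 * PrefBandit.mleRate S A R δ n
                    + R * PrefBandit.covRate S A δ n)} := by
  refine ⟨256, by norm_num, 1000, by norm_num, ?_⟩
  intro S A R r hr ρ hρ d hd hne πstar hopt hC δ hδ0 hδ1 n hn
  have hSA := PrefBandit.two_le_card_of_mem_stdSimplex hd hne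
  have hSA' : 2 ≤ S * A := by exact_mod_cast hSA
  have hS : 0 < S := Nat.pos_of_ne_zero fun h => by simp [h] at hSA'
  have hA : 0 < A := Nat.pos_of_ne_zero fun h => by simp [h] at hSA'
  have hR : 0 ≤ R := (hr (⟨0, hS⟩, ⟨0, hA⟩)).1.trans (hr (⟨0, hS⟩, ⟨0, hA⟩)).2
  have hlog : 0 ≤ Real.log (1 / δ) := Real.log_nonneg (by rw [le_div_iff₀ hδ0]; linarith)
  have hS1 : (1 : ℝ) ≤ S := by exact_mod_cast hS
  have hA1 : (1 : ℝ) ≤ A := by exact_mod_cast hA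
  have hSA2 : 1 ≤ (S : ℝ) * A ^ 2 := by nlinarith
  have ht : 0 ≤ Real.log (2 * ((S : ℝ) * A ^ 2) / δ) :=
    Real.log_nonneg (by rw [le_div_iff₀ hδ0]; linarith)
  have hprob := PrefBandit.isProbabilityMeasure_sampleLaw (r := r) hd
  have : IsProbabilityMeasure (PrefBandit.dataLaw n d r) := by
    unfold PrefBandit.dataLaw; infer_instance
  have hB1 := (PrefBandit.dataLaw_score_le (n := n) (r := r) hd
    (K := 8 * Real.sqrt ((S : ℝ) * A + Real.log (1 / δ))) (by positivity)).trans
    (ENNReal.ofReal_le_ofReal (PrefBandit.score_tail_le hδ0 hlog hSA))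
  have hB2 := (PrefBandit.dataLaw_count_le (n := n) (r := r) hd
    (Real.log (2 * (S * A ^ 2) / δ))).trans (ENNReal.ofReal_le_ofReal (q := δ / 2) (by
      rw [Real.exp_neg, Real.exp_log (by positivity)]
      apply le_of_eq
      field_simp))
  set B1 := {D : Fin n → PrefBandit.Sample S A | ∃ v : Fin S × Fin A → ℝ,
    8 * Real.sqrt ((S : ℝ) * A + Real.log (1 / δ)) *
      Real.sqrt (∑ i, PrefBandit.gap v (PrefBandit.query (D i)) ^ 2)
      < ∑ i, PrefBandit.noise r (D i) * PrefBandit.gap v (PrefBandit.query (D i))}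
  set B2 := {D : Fin n → PrefBandit.Sample S A | ∃ c,
    PrefBandit.count D c + Real.log (2 * (S * A ^ 2) / δ) ≤ n * d c / 2}
  have hunion : PrefBandit.dataLaw n d r (B1 ∪ B2) ≤ ENNReal.ofReal δ := by
    refine (measure_union_le _ _).trans ((add_le_add hB1 hB2).trans ?_)
    rw [← ENNReal.ofReal_add (by positivity) (by positivity), add_halves]
  have hcompl : ENNReal.ofReal (1 - δ) ≤ PrefBandit.dataLaw n d r (B1 ∪ B2)ᶜ := by
    -- The space of datasets is finite, so every event is measurable.
    rw [prob_compl_eq_one_sub (Set.toFinite _).measurableSet,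
      ENNReal.ofReal_sub _ hδ0.le, ENNReal.ofReal_one]
    exact tsub_le_tsub_left hunion 1
  refine hcompl.trans (measure_mono fun D hD π hπ => ?_)
  simp only [B1, B2, Set.mem_compl_iff, Set.mem_union, Set.mem_ofPred_eq, not_or, not_exists,
    not_lt, not_le] at hD
  exact PrefBandit.subOpt_le_of_concentration hr hρ hd hopt.1 hC hR hn hδ0 hlog hSA hD.1 hD.2
    ht hπ
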